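/- Let $G$ be an $r$-dimensional Lie group acting smoothly on an $m$-dimensional smooth manifold $M$, and assume that the action is locally effective on subsets: for every non-empty open $U\subseteq M$ the set $\{g\in G : g\cdot p=p \text{ for all } p\in U\}$ is a discrete subset of $G$. Let $G$ act on $M^{\times (n)}=M\times\dots\times M$ by $g\cdot(p_1,\dots,p_n)=(g\cdot p_1,\dots,g\cdot p_n)$, let $s_n$ be the maximal dimension of an orbit of this action, and let $n_0$ be the minimal integer such that $s_n=r$ for all $n\ge n_0$ (that is, from $n_0$ points on, the Cartesian action is locally free somewhere). Let $n\ge 0$ and let $U\subseteq M^{\times(n+1)}$ be open and non-empty. An $(n+1)$-point joint invariant on $U$ is a function $I:U\to\mathbb R$ with $I(g\cdot x)=I(x)$ whenever $g\in G$ and $x,\ g\cdot x\in U$. An $m$-tuple $I_1,\dots,I_m$ of such invariants is called * *$(n+1)$-st point reductive* on $U$ if for every $c\in\mathbb R^m$ and every $(p_1,\dots,p_n)$ in the projection of $U$ to the first $n$ points, the slice $\{(p_1,\dots,p_n,q)\in U\}$ contains at most one point at which $I_1=c_1,\dots,I_m=c_m$; * *$n$-point projectable* on $U$ (with respect to $k$-gons,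 $k\ge 1$) if, with all indices of the vertices of a polygon $(p_1,\dots,p_k)$ read modulo $k$, for every real matrix $C=(c_{i\rho})$ the set of all $(p_1,\dots,p_k)$ such that $(p_\rho,\dots,p_{\rho+n})\in U$ for all $\rho$ and $I_i(p_\rho,\dots,p_{\rho+n})=c_{i\rho}$ for $i=1,\dots,m$ and $\rho=1-n,\dots,1$ projects, under $(p_1,\dots,p_k)\mapsto(p_1,\dots,p_n)$, onto a set $V\cap O$, where $V\subseteq M^{\times(n)}$ is open and $O$ is an orbit of $G$ in $M^{\times(n)}$; * *perfect* on $U$ if it is both $n$-point projectable and $(n+1)$-st point reductive on $U$. Then: 1. If $n<n_0$, there are no $m$ $(n+1)$-point joint invariants which are perfect on $U$ (for any $k\ge1$). 2. If there are $m$ $(n+1)$-point joint invariants which are $(n+1)$-st point reductive on $U$, then $n+1\ge n_0+1$. In other words, there are no $m$ $N$-point joint invariants which are $N$-th point reductive on a non-empty open set with $1\le N\le n_0$. -/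

import Mathlib

open scoped Manifold ContDiff

namespace JointInv

/-- `G` acts locally effectively on subsets of `M`: for every non-empty open `U ⊆ M`, the set of
all `g` fixing every point of `U` is a discrete subset of `G`. -/
def LocallyEffectiveOnSubsets (G M : Type*) [Group G] [TopologicalSpace G] [TopologicalSpace M]
    [MulAction G M] : Prop :=
  ∀ U : Set M, IsOpen U → U.Nonempty →
    DiscreteTopology ↥{g : G | ∀ p ∈ U, g • p = p}

section OrbitDimension

variable (r m : ℕ) (G M : Type*)
  [TopologicalSpace G] [Group G] [ChartedSpace (EuclideanSpace ℝ (Fin r)) G]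
  [TopologicalSpace M] [ChartedSpace (EuclideanSpace ℝ (Fin m)) M] [MulAction G M]

/-- The dimension of the orbit of `p = (p₁, …, pₙ)` under the action of the `r`-dimensional Lie
group `G` on `M × ⋯ × M` (`n` copies) given by `g • (p₁, …, pₙ) = (g • p₁, …, g • pₙ)`. The tangent
space of the orbit at `p` is the range of the derivative at `1` of the orbit map
`g ↦ (g • p₁, …, g • pₙ)`, and the orbit dimension is the dimension of this range. -/
noncomputable def orbitDim (n : ℕ) (p : Fin n → M) : ℕ :=
  Module.finrank ℝ (LinearMap.range (LinearMap.pi fun i : Fin n =>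
    (mfderiv (𝓡 r) (𝓡 m) (fun g : G => g • p i) 1).toLinearMap))

/-- `sₙ`, the maximal orbit dimension of the action of `G` on `n` copies of `M`. (Orbit dimensions
are at most `r`, so the supremum is a maximum as soon as there is a point.) -/
noncomputable def maxOrbitDim (n : ℕ) : ℕ :=
  ⨆ p : Fin n → M, orbitDim r m G M n p

/-- `n₀`, the minimal integer such that `sₙ = r` for all `n ≥ n₀`. It is formed in `ℕ∞`, so that no
existence statement is presupposed (it would be `⊤` if there were no such integer). -/
noncomputable def minFreePoints : ℕ∞ :=
  sInf ((fun N : ℕ => (N : ℕ∞)) '' {N : ℕ | ∀ n : ℕ, N ≤ n → maxOrbitDim r m G M n = r})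

end OrbitDimension

section Invariants

variable (G : Type*) {M : Type*} [Group G] [MulAction G M]

/-- `f` is an `n`-point joint invariant on `U`: a real function on `U` that is unchanged under the
action of `G` on `n`-tuples of points. Only the values of `f` on `U` matter. -/
def IsJointInvariantOn {n : ℕ} (U : Set (Fin n → M)) (f : (Fin n → M) → ℝ) : Prop :=
  ∀ g : G, ∀ x ∈ U, g • x ∈ U → f (g • x) = f x

/-- For a closed polygon `p` with `k` vertices, indexed cyclically by `ZMod k`, the `n` consecutive
vertices starting at the vertex number `r`. -/
def window {k : ℕ} (n : ℕ) (p : ZMod k → M) (r : ℤ) : Fin n → M :=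
  fun l => p ((r + (l : ℤ) : ℤ) : ZMod k)

/-- The `k`-gons all of whose cyclic windows of `n` consecutive vertices lie in `U`. -/
def polygonsIn {n : ℕ} (k : ℕ) (U : Set (Fin n → M)) : Set (ZMod k → M) :=
  {p | ∀ r : ℤ, window n p r ∈ U}

/-- The level set of the functions `I_{i,r}(p) = Iᵢ(p_r, …, p_{r+n})`, where `r` runs through
`n + 1` consecutive values and ends at the first vertex; the first vertex has number `0` here, so
that `r = -j` for `j = 0, …, n`. The vertices that enter are `p_{-n}, …, p_n`. -/
def polygonLevelSet {m n : ℕ} (k : ℕ) (U : Set (Fin (n + 1) → M))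
    (I : Fin m → (Fin (n + 1) → M) → ℝ) (C : Fin m → Fin (n + 1) → ℝ) : Set (ZMod k → M) :=
  {p | p ∈ polygonsIn k U ∧
    ∀ (i : Fin m) (j : Fin (n + 1)), I i (window (n + 1) p (-(j : ℤ))) = C i j}

/-- The `(n + 1)`-point functions `I₁, …, I_m` are `n`-point projectable on `U`, with respect to
`k`-gons: every level set of the `I_{i,r}` projects, under
`(p₁, …, p_k) ↦ (p₁, …, p_n)` (cyclically extended if `k < n`), onto a set `V ∩ O` with
`V` open in the space of `n`-tuples and `O` an orbit of `G` on `n`-tuples. -/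
def IsProjectableOn [TopologicalSpace M] {m n : ℕ} (k : ℕ) (U : Set (Fin (n + 1) → M))
    (I : Fin m → (Fin (n + 1) → M) → ℝ) : Prop :=
  ∀ C : Fin m → Fin (n + 1) → ℝ, ∃ (V : Set (Fin n → M)) (q : Fin n → M), IsOpen V ∧
    (fun p => window n p 0) '' polygonLevelSet k U I C = V ∩ MulAction.orbit G q

/-- The `(n + 1)`-point functions `I₁, …, I_m` are reductive in the last point on `U`: for all
`c ∈ ℝᵐ` and all `(p₁, …, p_n)` in the projection of `U`, the level set
`{x ∈ U | I₁ x = c₁, …, I_m x = c_m}` meets the slice `{x ∈ U | x = (p₁, …, p_n, *)}` at most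
once. -/
def IsReductiveOn {m n : ℕ} (U : Set (Fin (n + 1) → M))
    (I : Fin m → (Fin (n + 1) → M) → ℝ) : Prop :=
  ∀ c : Fin m → ℝ, ∀ p ∈ (fun x : Fin (n + 1) → M => Fin.init x) '' U,
    ({x | x ∈ U ∧ ∀ i, I i x = c i} ∩ {x | x ∈ U ∧ Fin.init x = p}).Subsingleton

/-- Perfect: projectable and reductive. -/
def IsPerfectOn [TopologicalSpace M] {m n : ℕ} (k : ℕ) (U : Set (Fin (n + 1) → M))
    (I : Fin m → (Fin (n + 1) → M) → ℝ) : Prop :=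
  IsProjectableOn G k U I ∧ IsReductiveOn U I

end Invariants

end JointInv

open Filter Topology

namespace JointInv

/-! Reductivity alone forces the action on `n` points to be infinitesimally free. Let `X` in the Lie
algebra fix `x₁, …, xₙ` infinitesimally, with `x ∈ U`. The integral curve `γ` of the left-invariant
field of `X` then fixes these points for small `t` (`exists_curve_smul_eq`). For `q` near the last
point, the tuples ending in `q` and in `γ t • q` lie in `U` and share their first `n` points and all
invariants, so `γ t • q = q`. Thus `γ t` fixes an open set pointwise; the discreteness hypothesis
gives `γ t = 1` for small `t`, hence `X = 0` (`orbitDim_init_eq_of_isReductiveOn`). Extra points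
only shrink the infinitesimal stabilizer, so `n₀ ≤ n`, which yields both claims. -/

/-- A curve in a manifold whose derivative vanishes near `t₀` is constant near `t₀`. -/
theorem eventually_eq_of_eventually_hasMFDerivAt_zero {m : ℕ} {M : Type*} [TopologicalSpace M]
    [ChartedSpace (EuclideanSpace ℝ (Fin m)) M] [IsManifold (𝓡 m) 1 M] {c : ℝ → M} {t₀ : ℝ}
    (hc : ∀ᶠ t in 𝓝 t₀, HasMFDerivAt 𝓘(ℝ, ℝ) (𝓡 m) c t 0) :
    ∀ᶠ t in 𝓝 t₀, c t = c t₀ := by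
  have hcont : ContinuousAt c t₀ := hc.self_of_nhds.continuousAt
  have hsrc : ∀ᶠ t in 𝓝 t₀, c t ∈ (chartAt (EuclideanSpace ℝ (Fin m)) (c t₀)).source :=
    hcont.eventually ((chartAt _ (c t₀)).open_source.mem_nhds (mem_chart_source _ _))
  obtain ⟨ε, hε, hball⟩ := Metric.eventually_nhds_iff_ball.1 (hc.and hsrc)
  -- On this ball the curve stays in one chart, so the vector-space mean value argument applies.
  have hderiv : ∀ t ∈ Metric.ball t₀ ε,
      HasFDerivAt (extChartAt (𝓡 m) (c t₀) ∘ c) (0 : ℝ →L[ℝ] EuclideanSpace ℝ (Fin m)) t := by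
    intro t ht
    refine hasMFDerivAt_iff_hasFDerivAt.1 ?_
    exact (HasMFDerivAt.comp t (hasMFDerivAt_extChartAt (I := 𝓡 m) (hball t ht).2)
      (hball t ht).1).congr_mfderiv (ContinuousLinearMap.comp_zero _)
  refine Metric.eventually_nhds_iff_ball.2 ⟨ε, hε, fun t ht => ?_⟩
  have h₀ : t₀ ∈ Metric.ball t₀ ε := Metric.mem_ball_self hε
  have heq : extChartAt (𝓡 m) (c t₀) (c t) = extChartAt (𝓡 m) (c t₀) (c t₀) :=
    (convex_ball t₀ ε).is_const_of_fderivWithin_eq_zero (𝕜 := ℝ)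
      (fun s hs => (hderiv s hs).differentiableAt.differentiableWithinAt)
      (fun s hs => by
        rw [fderivWithin_of_isOpen Metric.isOpen_ball hs, (hderiv s hs).fderiv]) ht h₀
  refine (extChartAt (𝓡 m) (c t₀)).injOn ?_ (mem_extChartAt_source _) heq
  rw [extChartAt_source]
  exact (hball t ht).2

section Action

variable {r m : ℕ} {G M : Type*}
  [TopologicalSpace G] [Group G] [ChartedSpace (EuclideanSpace ℝ (Fin r)) G]
  [TopologicalSpace M] [ChartedSpace (EuclideanSpace ℝ (Fin m)) M] [MulAction G M]

/-! ### Orbit maps and infinitesimal stabilizers -/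

theorem mdifferentiable_smul_const
    (hsmooth : ContMDiff ((𝓡 r).prod (𝓡 m)) (𝓡 m) ∞ (fun x : G × M => x.1 • x.2)) (p : M) :
    MDifferentiable (𝓡 r) (𝓡 m) (fun g : G => g • p) :=
  (hsmooth.comp (contMDiff_id.prodMk contMDiff_const)).mdifferentiable (by simp)

theorem mdifferentiable_const_smul
    (hsmooth : ContMDiff ((𝓡 r).prod (𝓡 m)) (𝓡 m) ∞ (fun x : G × M => x.1 • x.2)) (g : G) :
    MDifferentiable (𝓡 m) (𝓡 m) (fun p : M => g • p) :=
  (hsmooth.comp (contMDiff_const.prodMk contMDiff_id)).mdifferentiable (by simp)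

theorem orbitDim_eq_of_forall_eq_zero {n : ℕ} {p : Fin n → M}
    (h : ∀ X : GroupLieAlgebra (𝓡 r) G,
      (∀ i, mfderiv (𝓡 r) (𝓡 m) (fun g : G => g • p i) 1 X = 0) → X = 0) :
    orbitDim r m G M n p = r := by
  unfold orbitDim
  rw [LinearMap.finrank_range_of_inj]
  · exact finrank_euclideanSpace_fin
  · refine (injective_iff_map_eq_zero _).2 fun X hX => h X fun i => ?_
    exact congr_fun hX i

theorem eq_zero_of_orbitDim_eq {n : ℕ} {p : Fin n → M} (h : orbitDim r m G M n p = r)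
    {X : GroupLieAlgebra (𝓡 r) G}
    (hX : ∀ i, mfderiv (𝓡 r) (𝓡 m) (fun g : G => g • p i) 1 X = 0) : X = 0 := by
  have : FiniteDimensional ℝ (TangentSpace (𝓡 r) (1 : G)) :=
    inferInstanceAs (FiniteDimensional ℝ (EuclideanSpace ℝ (Fin r)))
  unfold orbitDim at h
  set L := LinearMap.pi fun i : Fin n =>
    (mfderiv (𝓡 r) (𝓡 m) (fun g : G => g • p i) 1).toLinearMap
  have hrank := L.finrank_range_add_finrank_ker
  have hr : Module.finrank ℝ (TangentSpace (𝓡 r) (1 : G)) = r := finrank_euclideanSpace_fin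
  have hker : L.ker = ⊥ := Submodule.finrank_eq_zero.1 (by omega)
  have hXk : X ∈ L.ker := LinearMap.mem_ker.2 (funext hX)
  rw [hker] at hXk
  exact hXk

theorem orbitDim_le (n : ℕ) (p : Fin n → M) : orbitDim r m G M n p ≤ r := by
  have : FiniteDimensional ℝ (TangentSpace (𝓡 r) (1 : G)) :=
    inferInstanceAs (FiniteDimensional ℝ (EuclideanSpace ℝ (Fin r)))
  exact (LinearMap.finrank_range_le _).trans_eq finrank_euclideanSpace_fin

theorem maxOrbitDim_eq_of_orbitDim_eq {n : ℕ} {p : Fin n → M} (h : orbitDim r m G M n p = r) :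
    maxOrbitDim r m G M n = r := by
  have : Nonempty (Fin n → M) := ⟨p⟩
  refine le_antisymm (ciSup_le (orbitDim_le n)) ?_
  exact h.symm.le.trans
    (le_ciSup (f := orbitDim r m G M n) ⟨r, by rintro _ ⟨q, rfl⟩; exact orbitDim_le n q⟩ p)

/-- Left translation by `1` is the identity; this recovers `X` from the velocity of its integral
curve at time `0`. -/
theorem mulInvariantVectorField_one (X : GroupLieAlgebra (𝓡 r) G) :
    mulInvariantVectorField X (1 : G) = X := by
  have h : HasMFDerivAt (𝓡 r) (𝓡 r) (fun h : G => 1 * h) 1 (ContinuousLinearMap.id ℝ _) :=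
    (hasMFDerivAt_id (1 : G)).congr_of_eventuallyEq (Eventually.of_forall one_mul)
  exact DFunLike.congr_fun h.mfderiv X

variable [LieGroup (𝓡 r) ∞ G]

/-- If `X` is in the kernel of the derivative at `1` of the orbit map of `p`, then the
left-invariant vector field of `X` is everywhere in the kernel of its derivative. -/
theorem mfderiv_smul_mulInvariantVectorField_eq_zero
    (hsmooth : ContMDiff ((𝓡 r).prod (𝓡 m)) (𝓡 m) ∞ (fun x : G × M => x.1 • x.2)) {p : M}
    {X : GroupLieAlgebra (𝓡 r) G}
    (hX : mfderiv (𝓡 r) (𝓡 m) (fun g : G => g • p) 1 X = 0) (g : G) :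
    mfderiv (𝓡 r) (𝓡 m) (fun g : G => g • p) g (mulInvariantVectorField X g) = 0 := by
  have hL : HasMFDerivAt (𝓡 r) (𝓡 r) (fun h : G => g * h) 1
      (mfderiv (𝓡 r) (𝓡 r) (fun h : G => g * h) 1) :=
    ((contMDiff_mul_left (I := 𝓡 r) (n := ∞) (a := g)).mdifferentiable
      (by simp) 1).hasMFDerivAt
  have hO : HasMFDerivAt (𝓡 r) (𝓡 m) (fun g : G => g • p) (g * 1)
      (mfderiv (𝓡 r) (𝓡 m) (fun g : G => g • p) (g * 1)) :=
    (mdifferentiable_smul_const hsmooth p _).hasMFDerivAt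
  have hO₁ : HasMFDerivAt (𝓡 r) (𝓡 m) (fun g : G => g • p) 1
      (mfderiv (𝓡 r) (𝓡 m) (fun g : G => g • p) 1) :=
    (mdifferentiable_smul_const hsmooth p _).hasMFDerivAt
  have hS : HasMFDerivAt (𝓡 m) (𝓡 m) (fun q : M => g • q) ((1 : G) • p)
      (mfderiv (𝓡 m) (𝓡 m) (fun q : M => g • q) ((1 : G) • p)) :=
    (mdifferentiable_const_smul hsmooth g _).hasMFDerivAt
  have h₁ := HasMFDerivAt.comp (1 : G) hO hL
  have h₂ := HasMFDerivAt.comp (1 : G) hS hO₁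
  -- Equivariance of the orbit map; differentiating both sides at `1` transports the kernel from `1`
  -- to `g`.
  have hfun : (fun g : G => g • p) ∘ (fun h : G => g * h)
      = (fun q : M => g • q) ∘ (fun g : G => g • p) := by
    funext h
    exact mul_smul g h p
  rw [hfun] at h₁
  have h := DFunLike.congr_fun (hasMFDerivAt_unique h₁ h₂) X
  have h' : mfderiv (𝓡 r) (𝓡 m) (fun g : G => g • p) (g * 1) (mulInvariantVectorField X g)
      = mfderiv (𝓡 m) (𝓡 m) (fun q : M => g • q) ((1 : G) • p)
        (mfderiv (𝓡 r) (𝓡 m) (fun g : G => g • p) 1 X) := h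
  rw [hX, map_zero] at h'
  rwa [mul_one] at h'

variable [IsManifold (𝓡 m) ∞ M]

/-- An infinitesimal symmetry of finitely many points integrates to a curve in `G` that fixes
them. -/
theorem exists_curve_smul_eq
    (hsmooth : ContMDiff ((𝓡 r).prod (𝓡 m)) (𝓡 m) ∞ (fun x : G × M => x.1 • x.2)) {n : ℕ}
    {p : Fin n → M} {X : GroupLieAlgebra (𝓡 r) G}
    (hX : ∀ i, mfderiv (𝓡 r) (𝓡 m) (fun g : G => g • p i) 1 X = 0) :
    ∃ γ : ℝ → G, γ 0 = 1 ∧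
      HasMFDerivAt 𝓘(ℝ, ℝ) (𝓡 r) γ 0 ((1 : ℝ →L[ℝ] ℝ).smulRight
        (mulInvariantVectorField X (γ 0))) ∧
      ∀ᶠ t in 𝓝 (0 : ℝ), ∀ i, γ t • p i = p i := by
  have : LieGroup (𝓡 r) (minSmoothness ℝ 3) G := by
    rw [minSmoothness_of_isRCLikeNormedField]
    exact LieGroup.of_le (n := ∞) (ENat.LEInfty.out)
  have : IsManifold (𝓡 r) 1 G := IsManifold.of_le (n := ∞) (by exact_mod_cast le_top)
  have : IsManifold (𝓡 m) 1 M := IsManifold.of_le (n := ∞) (by exact_mod_cast le_top)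
  obtain ⟨γ, hγ₀, hγ⟩ := exists_isMIntegralCurveAt_of_contMDiffAt_boundaryless (I := 𝓡 r) 0
    ((contMDiffAt_mulInvariantVectorField X (g := (1 : G))).of_le (by
      rw [minSmoothness_of_isRCLikeNormedField]; exact one_le_two))
  refine ⟨γ, hγ₀, hγ.self_of_nhds, eventually_all.2 fun i => ?_⟩
  have hconst := eventually_eq_of_eventually_hasMFDerivAt_zero (m := m)
    (c := fun t => γ t • p i) (t₀ := 0) <| by
      filter_upwards [hγ] with t ht
      refine (HasMFDerivAt.comp t (mdifferentiable_smul_const hsmooth (p i) (γ t)).hasMFDerivAt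
        ht).congr_mfderiv ?_
      refine ContinuousLinearMap.ext fun a => ?_
      change mfderiv (𝓡 r) (𝓡 m) (fun g : G => g • p i) (γ t)
        ((show ℝ from a) • mulInvariantVectorField X (γ t)) = 0
      rw [map_smul, mfderiv_smul_mulInvariantVectorField_eq_zero hsmooth (hX i), smul_zero]
  filter_upwards [hconst] with t ht
  simpa [hγ₀] using ht

/-- If `(n + 1)`-point joint invariants are reductive on `U`, then the action on `n`-tuples is
infinitesimally free at the first `n` points of every element of `U`. -/
theorem orbitDim_init_eq_of_isReductiveOn
    (hsmooth : ContMDiff ((𝓡 r).prod (𝓡 m)) (𝓡 m) ∞ (fun x : G × M => x.1 • x.2))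
    (heff : LocallyEffectiveOnSubsets G M) {n k : ℕ} {U : Set (Fin (n + 1) → M)} (hU : IsOpen U)
    {I : Fin k → (Fin (n + 1) → M) → ℝ} (hI : ∀ i, IsJointInvariantOn G U (I i))
    (hred : IsReductiveOn U I) {x : Fin (n + 1) → M} (hx : x ∈ U) :
    orbitDim r m G M n (Fin.init x) = r := by
  refine orbitDim_eq_of_forall_eq_zero fun X hX => ?_
  obtain ⟨γ, hγ₀, hγ, hfix⟩ := exists_curve_smul_eq hsmooth hX
  have hsnoc : Continuous fun q : M => (Fin.snoc (Fin.init x) q : Fin (n + 1) → M) := by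
    fun_prop
  have hsmul : Tendsto (fun y : G × M => y.1 • y.2) (𝓝 (1, x (Fin.last n)))
      (𝓝 (x (Fin.last n))) := by
    simpa using hsmooth.continuous.tendsto (1, x (Fin.last n))
  have hW : {q : M | (Fin.snoc (Fin.init x) q : Fin (n + 1) → M) ∈ U} ∈ 𝓝 (x (Fin.last n)) :=
    (hU.preimage hsnoc).mem_nhds (by simpa using hx)
  have hNK := hsmul hW
  -- Product neighbourhoods give one `N ∋ 1` that serves all `q ∈ K`, so the bound on `t` below does
  -- not depend on `q`.
  rw [nhds_prod_eq] at hNK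
  obtain ⟨N, hN, K₀, hK₀, hNK⟩ := Filter.mem_prod_iff.1 hNK
  obtain ⟨K, hK, hKo, hqK⟩ := mem_nhds_iff.1 hK₀
  have hone : (1 : G) ∈ {g : G | ∀ q ∈ K, g • q = q} := fun q _ => one_smul G q
  have hγfix : ∀ᶠ t in 𝓝 (0 : ℝ), γ t ∈ {g : G | ∀ q ∈ K, g • q = q} := by
    have hγN : ∀ᶠ t in 𝓝 (0 : ℝ), γ t ∈ N := hγ.continuousAt.eventually (by rwa [hγ₀])
    filter_upwards [hfix, hγN] with t ht htN q hq
    have hmem : (Fin.snoc (Fin.init x) q : Fin (n + 1) → M) ∈ U := by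
      have : (1 : G) • q ∈ {q : M | (Fin.snoc (Fin.init x) q : Fin (n + 1) → M) ∈ U} :=
        hNK (Set.mk_mem_prod (mem_of_mem_nhds hN) (hK hq))
      simpa using this
    have hmem' : (Fin.snoc (Fin.init x) (γ t • q) : Fin (n + 1) → M) ∈ U :=
      hNK (Set.mk_mem_prod htN (hK hq))
    have heq : γ t • (Fin.snoc (Fin.init x) q : Fin (n + 1) → M)
        = Fin.snoc (Fin.init x) (γ t • q) := by
      funext j
      refine Fin.lastCases ?_ (fun i => ?_) j
      · simp
      · simpa using ht i
    -- The constants are the values of the invariants at the tuple ending in `q`; invariance puts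
    -- the moved tuple in the same level set.
    have hsub := hred (fun i => I i (Fin.snoc (Fin.init x) q)) (Fin.init x) ⟨x, hx, rfl⟩
      (x := Fin.snoc (Fin.init x) (γ t • q)) (y := Fin.snoc (Fin.init x) q)
      ⟨⟨hmem', fun i => by rw [← heq]; exact hI i _ _ hmem (heq ▸ hmem')⟩,
        hmem', Fin.init_snoc _ _⟩
      ⟨⟨hmem, fun i => rfl⟩, hmem, Fin.init_snoc _ _⟩
    simpa using congr_fun hsub (Fin.last n)
  have hγone : ∀ᶠ t in 𝓝 (0 : ℝ), γ t = 1 := by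
    have hdisc := heff K hKo ⟨_, hqK⟩
    -- `O` isolates `1` within the pointwise stabilizer of `K`.
    obtain ⟨O, hO, hOS⟩ := isOpen_induced_iff.1 
      (isOpen_discrete {(⟨1, hone⟩ : {g : G | ∀ q ∈ K, g • q = q})})
    have h1O : (1 : G) ∈ O := by
      have : (⟨1, hone⟩ : {g : G | ∀ q ∈ K, g • q = q}) ∈ Subtype.val ⁻¹' O := by
        rw [hOS]; rfl
      exact this
    have hγO : ∀ᶠ t in 𝓝 (0 : ℝ), γ t ∈ O :=
      hγ.continuousAt.eventually (hO.mem_nhds (by rwa [hγ₀]))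
    filter_upwards [hγfix, hγO] with t ht htO
    have : (⟨γ t, ht⟩ : {g : G | ∀ q ∈ K, g • q = q}) ∈ Subtype.val ⁻¹' O := htO
    rw [hOS] at this
    exact congr_arg Subtype.val this
  have hzero : HasMFDerivAt 𝓘(ℝ, ℝ) (𝓡 r) γ 0 0 :=
    (hasMFDerivAt_const (1 : G) (0 : ℝ)).congr_of_eventuallyEq hγone
  have h := DFunLike.congr_fun (hasMFDerivAt_unique hγ hzero) (1 : ℝ)
  have h' : (1 : ℝ) • mulInvariantVectorField X (γ 0) = 0 := h
  rw [one_smul, hγ₀, mulInvariantVectorField_one] at h'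
  exact h'

theorem minFreePoints_le_of_isReductiveOn
    (hsmooth : ContMDiff ((𝓡 r).prod (𝓡 m)) (𝓡 m) ∞ (fun x : G × M => x.1 • x.2))
    (heff : LocallyEffectiveOnSubsets G M) {n k : ℕ} {U : Set (Fin (n + 1) → M)} (hU : IsOpen U)
    (hne : U.Nonempty) {I : Fin k → (Fin (n + 1) → M) → ℝ}
    (hI : ∀ i, IsJointInvariantOn G U (I i)) (hred : IsReductiveOn U I) :
    minFreePoints r m G M ≤ n := by
  obtain ⟨x, hx⟩ := hne
  have hdim := orbitDim_init_eq_of_isReductiveOn hsmooth heff hU hI hred hx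
  refine sInf_le ⟨n, fun n' hn' => ?_, rfl⟩
  -- The padding value is immaterial: the first `n` points already have trivial infinitesimal
  -- stabilizer.
  let p : Fin n' → M := fun i => if h : (i : ℕ) < n then Fin.init x ⟨i, h⟩ else x (Fin.last n)
  refine maxOrbitDim_eq_of_orbitDim_eq (p := p) (orbitDim_eq_of_forall_eq_zero fun X hX => ?_)
  refine eq_zero_of_orbitDim_eq hdim fun i => ?_
  have hi := hX (Fin.castLE hn' i)
  have hpi : p (Fin.castLE hn' i) = Fin.init x i := by simp [p]
  rwa [hpi] at hi

end Action

end JointInv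

theorem mainTheorem7 {r m : ℕ} {G M : Type*}
    [TopologicalSpace G] [Group G] [ChartedSpace (EuclideanSpace ℝ (Fin r)) G]
    [LieGroup (𝓡 r) ∞ G]
    [TopologicalSpace M] [ChartedSpace (EuclideanSpace ℝ (Fin m)) M] [IsManifold (𝓡 m) ∞ M]
    [MulAction G M]
    (hsmooth : ContMDiff ((𝓡 r).prod (𝓡 m)) (𝓡 m) ∞ (fun x : G × M => x.1 • x.2))
    (heff : JointInv.LocallyEffectiveOnSubsets G M) :
    (∀ n : ℕ, (n : ℕ∞) < JointInv.minFreePoints r m G M →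
      ∀ U : Set (Fin (n + 1) → M), IsOpen U → U.Nonempty →
        ∀ k : ℕ, 1 ≤ k →
          ¬ ∃ I : Fin m → (Fin (n + 1) → M) → ℝ,
            (∀ i, JointInv.IsJointInvariantOn G U (I i)) ∧ JointInv.IsPerfectOn G k U I) ∧
    (∀ n : ℕ, ∀ U : Set (Fin (n + 1) → M), IsOpen U → U.Nonempty →
      (∃ I : Fin m → (Fin (n + 1) → M) → ℝ,
        (∀ i, JointInv.IsJointInvariantOn G U (I i)) ∧ JointInv.IsReductiveOn U I) →
      JointInv.minFreePoints r m G M + 1 ≤ ((n + 1 : ℕ) : ℕ∞)) := by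
  have key : ∀ (n : ℕ) (U : Set (Fin (n + 1) → M)), IsOpen U → U.Nonempty →
      (∃ I : Fin m → (Fin (n + 1) → M) → ℝ,
        (∀ i, JointInv.IsJointInvariantOn G U (I i)) ∧ JointInv.IsReductiveOn U I) →
      JointInv.minFreePoints r m G M ≤ n := fun n U hU hne ⟨_, hI, hred⟩ =>
    JointInv.minFreePoints_le_of_isReductiveOn hsmooth heff hU hne hI hred
  refine ⟨fun n hn U hU hne k _ ⟨I, hI, hperf⟩ => ?_, fun n U hU hne h => ?_⟩
  · exact hn.not_ge (key n U hU hne ⟨I, hI, hperf.2⟩)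
  · rw [Nat.cast_succ]
    gcongr
    exact key n U hU hne h
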